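/- Let $d\in\mathbb N$. For $z=(x,\omega)\in\mathbb R^{2d}$ let $\pi(z)$ be the time-frequency shift on $L^2(\mathbb R^d)$, $\pi(z)f(t)=e^{2\pi i\,t\cdot\omega}f(t-x)$. For operators $S,T$ of trace class on $L^2(\mathbb R^d)$ put $\check T=PTP$ with $Pf(t)=f(-t)$, $\alpha_z(T)=\pi(z)T\pi(z)^*$ and $S\star T(z)=\mathrm{tr}(S\,\alpha_z(\check T))$. Let $S$ be a positive trace class operator on $L^2(\mathbb R^d)$ with $\mathrm{tr}(S)=1$, and let $$\tilde S(z)=S\star\check S(z)\qquad(z\in\mathbb R^{2d}),$$ which is a nonnegative function. Let $\Omega\subset\mathbb R^{2d}$ be compact with Lebesgue measure $|\Omega|>0$, and let $$\mathrm{ALC}(\tilde S,\Omega)=\frac1{|\Omega|}\int_\Omega\Bigl(1-\int_{\Omega-z}\tilde S(z')\,dz'\Bigr)dz .$$ Let $|\partial\Omega|\in[0,\infty]$ be the total variation of $\chi_\Omega$, $$|\partial\Omega|=\sup\Bigl\{\int_{\Omega}\operatorname{div}\phi(z)\,dz:\ \phi\in C^1_c(\mathbb R^{2d},\mathbb R^{2d}),\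 |\phi(z)|\le1\ \text{for all }z\Bigr\},$$ where $|\cdot|$ is the Euclidean norm. Then $$\mathrm{ALC}(\tilde S,\Omega)\le\frac{|\partial\Omega|}{|\Omega|}\int_{\mathbb R^{2d}}\tilde S(z)\,|z|\,dz ,$$ an inequality in $[0,\infty]$, where the right-hand side may be infinite. -/

import Mathlib

noncomputable section

namespace QHA

open MeasureTheory
open scoped ENNReal InnerProductSpace

/-- The signal space `L²(ℝᵈ)`. -/
abbrev Signal (d : ℕ) : Type :=
  Lp ℂ 2 (volume : Measure (EuclideanSpace ℝ (Fin d)))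

/-- The phase space `ℝ²ᵈ`, with Euclidean norm and Lebesgue measure; a point is `z = (x, ω)`
with `x` the coordinates in the left summand and `ω` those in the right summand. -/
abbrev Phase (d : ℕ) : Type := EuclideanSpace ℝ (Fin d ⊕ Fin d)

/-- The time component `x` of `z = (x, ω)`. -/
def Phase.time {d : ℕ} (z : Phase d) : EuclideanSpace ℝ (Fin d) :=
  WithLp.toLp 2 fun i => z (Sum.inl i)

/-- The frequency component `ω` of `z = (x, ω)`. -/
def Phase.freq {d : ℕ} (z : Phase d) : EuclideanSpace ℝ (Fin d) :=
  WithLp.toLp 2 fun i => z (Sum.inr i)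

/-- The character `t ↦ e^{2πi t·ω}`. -/
def character {d : ℕ} (ω t : EuclideanSpace ℝ (Fin d)) : ℂ :=
  Complex.exp (2 * Real.pi * Complex.I * (⟪t, ω⟫_ℝ : ℝ))

theorem norm_character {d : ℕ} (ω t : EuclideanSpace ℝ (Fin d)) : ‖character ω t‖ = 1 := by
  have h : (2 * Real.pi * Complex.I * (⟪t, ω⟫_ℝ : ℝ) : ℂ)
      = ((2 * Real.pi * ⟪t, ω⟫_ℝ : ℝ) : ℂ) * Complex.I := by
    push_cast; ring
  rw [character, h, Complex.norm_exp_ofReal_mul_I]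

theorem continuous_character {d : ℕ} (ω : EuclideanSpace ℝ (Fin d)) :
    Continuous (character ω) := by
  unfold character
  fun_prop

theorem memLp_character_mul {d : ℕ} (ω : EuclideanSpace ℝ (Fin d)) (f : Signal d) :
    MemLp (fun t => character ω t * f t) 2 volume := by
  refine (Lp.memLp f).congr_norm
    ((continuous_character ω).aestronglyMeasurable.mul (Lp.aestronglyMeasurable f)) ?_
  exact Filter.Eventually.of_forall fun t => by simp [norm_character]

/-- Modulation `(M_ω f)(t) = e^{2πi t·ω} f(t)` on `L²(ℝᵈ)`. -/
def modulation {d : ℕ} (ω : EuclideanSpace ℝ (Fin d)) : Signal d →ₗᵢ[ℂ] Signal d where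
  toFun f := (memLp_character_mul ω f).toLp _
  map_add' f g := by
    rw [← MemLp.toLp_add]
    refine MemLp.toLp_congr _ _ ?_
    filter_upwards [Lp.coeFn_add f g] with t ht
    simp only [ht, Pi.add_apply, mul_add]
  map_smul' c f := by
    rw [RingHom.id_apply, ← MemLp.toLp_const_smul]
    refine MemLp.toLp_congr _ _ ?_
    filter_upwards [Lp.coeFn_smul c f] with t ht
    simp only [ht, Pi.smul_apply, smul_eq_mul]
    ring
  norm_map' f := by
    simp only [LinearMap.coe_mk, AddHom.coe_mk]
    rw [Lp.norm_toLp, Lp.norm_def]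
    congr 1
    exact eLpNorm_congr_norm_ae (Filter.Eventually.of_forall fun t => by simp [norm_character])

/-- Translation `(T_x f)(t) = f(t - x)` on `L²(ℝᵈ)`. -/
def translation {d : ℕ} (x : EuclideanSpace ℝ (Fin d)) : Signal d →ₗᵢ[ℂ] Signal d :=
  Lp.compMeasurePreservingₗᵢ ℂ (fun t => t - x) (measurePreserving_sub_right volume x)

/-- The time-frequency shift `(π(z) f)(t) = e^{2πi t·ω} f(t - x)` for `z = (x, ω)`. -/
def timeFreqShift {d : ℕ} (z : Phase d) : Signal d →L[ℂ] Signal d :=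
  ((modulation z.freq).comp (translation z.time)).toContinuousLinearMap

theorem coeFn_timeFreqShift {d : ℕ} (z : Phase d) (f : Signal d) :
    timeFreqShift z f =ᵐ[volume] fun t => character z.freq t * f (t - z.time) := by
  have h1 : timeFreqShift z f =ᵐ[volume]
      fun t => character z.freq t * (translation z.time f) t :=
    MemLp.coeFn_toLp (memLp_character_mul z.freq (translation z.time f))
  have h2 : translation z.time f =ᵐ[volume] f ∘ fun t => t - z.time :=
    Lp.coeFn_compMeasurePreserving f (measurePreserving_sub_right volume z.time)
  filter_upwards [h1, h2] with t h1 h2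
  rw [h1, h2, Function.comp_apply]

/-- The parity operator `(P f)(t) = f(-t)`. -/
def parity (d : ℕ) : Signal d →L[ℂ] Signal d :=
  (Lp.compMeasurePreservingₗᵢ ℂ (fun t => -t)
    (Measure.measurePreserving_neg volume)).toContinuousLinearMap

/-- The shifted operator `α_z(T) = π(z) T π(z)*`. -/
def opShift {d : ℕ} (z : Phase d) (T : Signal d →L[ℂ] Signal d) : Signal d →L[ℂ] Signal d :=
  timeFreqShift z ∘L T ∘L ContinuousLinearMap.adjoint (timeFreqShift z)

/-- The operator `Ť = P T P`. -/
def opCheck {d : ℕ} (T : Signal d →L[ℂ] Signal d) : Signal d →L[ℂ] Signal d :=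
  parity d ∘L T ∘L parity d

section Trace

variable (H : Type*) [NormedAddCommGroup H] [InnerProductSpace ℂ H] [CompleteSpace H]

/-- The index set of a fixed orthonormal basis of the Hilbert space `H`. -/
def basisIndex : Set H := (exists_hilbertBasis ℂ H).choose

/-- A fixed orthonormal basis of the Hilbert space `H`. -/
def someBasis : HilbertBasis (basisIndex H) ℂ H :=
  (exists_hilbertBasis ℂ H).choose_spec.choose

variable {H}

/-- `A` is of trace class: `∑ᵢ ⟨|A| eᵢ, eᵢ⟩ < ∞`, where `|A| = (A* A)^{1/2}`. The terms are
nonnegative reals and the value of the sum is the same for all orthonormal bases. -/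
def IsTraceClass (A : H →L[ℂ] H) : Prop :=
  Summable fun i => ⟪someBasis H i, CFC.abs A (someBasis H i)⟫_ℂ

/-- The trace `tr A = ∑ᵢ ⟨A eᵢ, eᵢ⟩`, which does not depend on the orthonormal basis when `A` is
of trace class (Mathlib's inner product is linear in its second argument). -/
def trace (A : H →L[ℂ] H) : ℂ :=
  ∑' i, ⟪someBasis H i, A (someBasis H i)⟫_ℂ

/-- A density operator: a positive trace class operator of trace one. -/
structure IsDensityOperator (S : H →L[ℂ] H) : Prop where
  isPositive : S.IsPositive
  isTraceClass : IsTraceClass S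
  trace_eq_one : trace S = 1

end Trace

/-- The convolution of two operators, `S ⋆ T (z) = tr (S α_z(Ť))`. -/
def opConv {d : ℕ} (S T : Signal d →L[ℂ] Signal d) (z : Phase d) : ℂ :=
  trace (S ∘L opShift z (opCheck T))

/-- The total correlation function `S̃ = S ⋆ Š`. For positive `S` the values of `S ⋆ Š` are
nonnegative real numbers, so taking the real part loses nothing. -/
def totalCorrelation {d : ℕ} (S : Signal d →L[ℂ] Signal d) (z : Phase d) : ℝ :=
  (opConv S (opCheck S) z).re

/-- The average lack of concentration of a function `f` with respect to `Ω`,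
`ALC(f, Ω) = |Ω|⁻¹ ∫_Ω (1 - ∫_{Ω - z} f(z') dz') dz`. -/
def ALC {d : ℕ} (f : Phase d → ℝ) (Ω : Set (Phase d)) : ℝ :=
  (volume.real Ω)⁻¹ * ∫ z in Ω, (1 - ∫ z' in {w | w + z ∈ Ω}, f z')

/-- The divergence of a vector field on `ℝⁿ`. -/
def divergence {ι : Type*} [Fintype ι] [DecidableEq ι]
    (φ : EuclideanSpace ℝ ι → EuclideanSpace ℝ ι) (x : EuclideanSpace ℝ ι) : ℝ :=
  ∑ i, (fderiv ℝ φ x (EuclideanSpace.single i 1)) i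

/-- The perimeter `|∂Ω|`, that is, the total variation of the indicator function of `Ω`: the
supremum in `[0, ∞]` of `∫_Ω div φ` over all compactly supported `C¹` vector fields `φ` with
`|φ| ≤ 1`. (As `φ = 0` is admissible, truncating negative integrals at `0` changes nothing.) -/
def perimeter {ι : Type*} [Fintype ι] [DecidableEq ι] (Ω : Set (EuclideanSpace ℝ ι)) : ℝ≥0∞ :=
  ⨆ (φ : EuclideanSpace ℝ ι → EuclideanSpace ℝ ι) (_ : ContDiff ℝ 1 φ)
    (_ : HasCompactSupport φ) (_ : ∀ x, ‖φ x‖ ≤ 1),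
    ENNReal.ofReal (∫ x in Ω, divergence φ x)

end QHA

end

/-! The function `totalCorrelation S` is a probability density on phase space. With `R` the square
root of `S` and `C = R π(z) R`, cyclicity of the trace gives `S̃(z) = tr (C C*) = ∑ᵢⱼ |⟨R eᵢ, π(z) R
eⱼ⟩|²`, which is nonnegative. Moyal's identity integrates each term to `‖R eᵢ‖² ‖R eⱼ‖²`, so the
total mass is `(tr S)² = 1` (`measurable_totalCorrelation_and_lintegral`).

For any probability density `f`, the defect `1 - ∫_{Ω - z} f` is the mass of `f` off `Ω - z`. By
Tonelli, `|Ω| ALC(f, Ω)` is then at most `∫ f(h) |{z ∈ Ω : z + h ∉ Ω}| dh` (`ofReal_ALC_le`).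

It remains to bound that measure by `|h| |∂Ω|` (`volume_inter_translate_compl_le`). For a bump
function `ψ`, the difference `ψ - ψ(· - h)` is the divergence of the average of `ψ` over the segment
from `x - h` to `x`, times the vector `h`. After division by `|h|` this field is admissible in the
supremum defining the perimeter. Letting `ψ` approximate the indicator of the escaping set gives the
bound. -/

noncomputable section

namespace QHA

open MeasureTheory
open scoped ENNReal InnerProductSpace
open FourierTransform

/-! ### Plancherel's theorem for Fourier integrals. -/

section Plancherel

variable {E : Type*} [NormedAddCommGroup E] [InnerProductSpace ℝ E] [FiniteDimensional ℝ E]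
  [MeasurableSpace E] [BorelSpace E]

/-- On `L¹ ∩ L²` the Fourier transform on `L²` is given by the Fourier integral. -/
theorem coeFn_fourier_toLp {F : E → ℂ} (hF₁ : Integrable F) (hF₂ : MemLp F 2) :
    (𝓕 (hF₂.toLp F) : Lp ℂ 2 (volume : Measure E)) =ᵐ[volume] (𝓕 F : E → ℂ) := by
  have hcont : Continuous (𝓕 F : E → ℂ) :=
    VectorFourier.fourierIntegral_continuous Real.continuous_fourierChar
      (by exact continuous_inner) hF₁
  -- Both sides are tested against smooth compactly supported `g`: duality for tempered
  -- distributions moves `𝓕` onto `g`, and the `L¹` multiplication formula moves it back to `F`.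
  refine ae_eq_of_integral_contDiff_smul_eq
    ((Lp.memLp _).locallyIntegrable (by norm_num)) hcont.locallyIntegrable fun g hg hgc => ?_
  have hg₁ : HasCompactSupport (Complex.ofRealCLM ∘ g) := hgc.comp_left rfl
  have hg₂ : ContDiff ℝ ((⊤ : ℕ∞) : WithTop ℕ∞) (Complex.ofRealCLM ∘ g) :=
    Complex.ofRealCLM.contDiff.comp hg
  set G := hg₁.toSchwartzMap hg₂ with hG
  have hGapp : ∀ x, G x = (g x : ℂ) := fun x => by simp [hG]
  have h := DFunLike.congr_fun (Lp.fourier_toTemperedDistribution_eq (hF₂.toLp F)) G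
  rw [TemperedDistribution.fourier_apply, Lp.toTemperedDistribution_apply,
    Lp.toTemperedDistribution_apply] at h
  have h1 : ∫ x, (𝓕 G) x • (hF₂.toLp F) x = ∫ x, (𝓕 G) x • F x := by
    refine integral_congr_ae ?_
    filter_upwards [hF₂.coeFn_toLp] with x hx
    rw [hx]
  have h2 : ∫ x, (𝓕 G) x • F x = ∫ x, G x • (𝓕 F : E → ℂ) x := by
    have := VectorFourier.integral_fourierIntegral_smul_eq_flip (L := innerₗ E)
      Real.continuous_fourierChar (by exact continuous_inner) (G.integrable (μ := volume)) hF₁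
    rw [flip_innerₗ] at this
    rw [SchwartzMap.fourier_coe]
    exact this
  rw [h1, h2] at h
  simp only [hGapp] at h
  exact h.symm

/-- Plancherel's theorem for the Fourier integral of a function in `L¹ ∩ L²`. -/
theorem lintegral_enorm_fourier_sq {F : E → ℂ} (hF₁ : Integrable F) (hF₂ : MemLp F 2) :
    ∫⁻ w, ‖(𝓕 F : E → ℂ) w‖ₑ ^ 2 = ∫⁻ t, ‖F t‖ₑ ^ 2 := by
  have key : ∀ G : E → ℂ, ∫⁻ t, ‖G t‖ₑ ^ 2 = eLpNorm G 2 volume ^ 2 := fun G => by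
    rw [eLpNorm_eq_lintegral_rpow_enorm_toReal (by norm_num) (by norm_num), ← ENNReal.rpow_natCast,
      ← ENNReal.rpow_mul]
    simp
  rw [key, key, ← eLpNorm_congr_ae (coeFn_fourier_toLp hF₁ hF₂), ← Lp.enorm_def,
    ← eLpNorm_congr_ae hF₂.coeFn_toLp, ← Lp.enorm_def, ← ofReal_norm, ← ofReal_norm,
    Lp.norm_fourier_eq]

end Plancherel

/-! ### Moyal's identity for time-frequency shifts. -/

section Moyal

variable {d : ℕ}

local notation "𝔼" => EuclideanSpace ℝ (Fin d)

theorem lintegral_enorm_sq_eq (f : Signal d) : ∫⁻ t, ‖f t‖ₑ ^ 2 = ‖f‖ₑ ^ 2 := by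
  rw [Lp.enorm_def, eLpNorm_eq_lintegral_rpow_enorm_toReal (by norm_num) (by norm_num),
    ← ENNReal.rpow_natCast, ← ENNReal.rpow_mul]
  simp

/-- The matrix coefficients of time-frequency shifts are Fourier transforms. -/
theorem inner_timeFreqShift_eq_fourier (f g : Signal d) (z : Phase d) :
    ⟪f, timeFreqShift z g⟫_ℂ =
      (𝓕 (fun t => starRingEnd ℂ (f t) * g (t - z.time)) : 𝔼 → ℂ) (-z.freq) := by
  rw [L2.inner_def, Real.fourier_eq']
  refine integral_congr_ae ?_
  filter_upwards [coeFn_timeFreqShift z g] with t ht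
  rw [ht, RCLike.inner_apply, character, inner_neg_right]
  simp only [smul_eq_mul]
  have : (2 * Real.pi * Complex.I * (⟪t, z.freq⟫_ℝ : ℝ) : ℂ)
      = ((-2 * Real.pi * -⟪t, z.freq⟫_ℝ : ℝ) : ℂ) * Complex.I := by
    push_cast; ring
  rw [this]
  ring

/-- Phase space as a product of time and frequency. -/
def phaseEquiv (d : ℕ) :
    Phase d ≃ᵐ EuclideanSpace ℝ (Fin d) × EuclideanSpace ℝ (Fin d) :=
  ((MeasurableEquiv.toLp 2 _).symm.trans (MeasurableEquiv.sumPiEquivProdPi fun _ => ℝ)).trans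
    ((MeasurableEquiv.toLp 2 _).prodCongr (MeasurableEquiv.toLp 2 _))

theorem phaseEquiv_apply (z : Phase d) : phaseEquiv d z = (z.time, z.freq) := rfl

theorem measurePreserving_phaseEquiv : MeasurePreserving (phaseEquiv d) volume volume := by
  have h := (EuclideanSpace.volume_preserving_symm_measurableEquiv_toLp (Fin d)).symm
  exact ((EuclideanSpace.volume_preserving_symm_measurableEquiv_toLp (Fin d ⊕ Fin d)).trans
    (volume_measurePreserving_sumPiEquivProdPi fun _ => ℝ)).trans (h.prod h)

theorem measurable_inner_timeFreqShift (f g : Signal d) :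
    Measurable fun z : Phase d => ⟪f, timeFreqShift z g⟫_ℂ := by
  have hf := (Lp.stronglyMeasurable f).measurable
  have hg := (Lp.stronglyMeasurable g).measurable
  have hm : Measurable fun p : (𝔼 × 𝔼) × 𝔼 =>
      character p.1.2 p.2 * (starRingEnd ℂ (f p.2) * g (p.2 - p.1.1)) := by
    have h1 : Measurable fun p : (𝔼 × 𝔼) × 𝔼 => character p.1.2 p.2 := by
      unfold character
      refine Continuous.measurable ?_
      fun_prop
    have h2 : Measurable fun p : (𝔼 × 𝔼) × 𝔼 => starRingEnd ℂ (f p.2) :=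
      Complex.continuous_conj.measurable.comp (hf.comp measurable_snd)
    exact h1.mul (h2.mul (hg.comp (by fun_prop)))
  have h := (hm.stronglyMeasurable.integral_prod_right' (ν := volume)).measurable.comp
    (phaseEquiv d).measurable
  convert h using 2 with z
  rw [L2.inner_def, Function.comp_apply, phaseEquiv_apply]
  refine integral_congr_ae ?_
  filter_upwards [coeFn_timeFreqShift z g] with t ht
  rw [ht, RCLike.inner_apply]
  ring

/-- Moyal's identity: `∫ |⟨f, π(z) g⟩|² dz = ‖f‖² ‖g‖²`. -/
theorem lintegral_enorm_inner_timeFreqShift_sq (f g : Signal d) :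
    ∫⁻ z : Phase d, ‖⟪f, timeFreqShift z g⟫_ℂ‖ₑ ^ 2 = ‖f‖ₑ ^ 2 * ‖g‖ₑ ^ 2 := by
  have hf := (Lp.stronglyMeasurable f).measurable
  have hg := (Lp.stronglyMeasurable g).measurable
  set F : 𝔼 → 𝔼 → ℂ := fun x t => starRingEnd ℂ (f t) * g (t - x) with hF
  have hFm : Measurable F.uncurry := by
    have h2 : Measurable fun p : 𝔼 × 𝔼 => starRingEnd ℂ (f p.2) :=
      Complex.continuous_conj.measurable.comp (hf.comp measurable_snd)
    exact h2.mul (hg.comp (by fun_prop))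
  have hsq : ∀ x t, ‖F x t‖ₑ ^ 2 = ‖f t‖ₑ ^ 2 * ‖g (t - x)‖ₑ ^ 2 := fun x t => by
    rw [hF, enorm_mul, mul_pow]
    congr 2
    rw [← ofReal_norm, ← ofReal_norm, RCLike.norm_conj]
  have htot : ∫⁻ x, ∫⁻ t, ‖F x t‖ₑ ^ 2 = ‖f‖ₑ ^ 2 * ‖g‖ₑ ^ 2 := by
    rw [lintegral_lintegral_swap (by exact (hFm.enorm.pow_const 2).aemeasurable)]
    simp_rw [hsq]
    have : ∀ t, ∫⁻ x, ‖f t‖ₑ ^ 2 * ‖g (t - x)‖ₑ ^ 2 = ‖f t‖ₑ ^ 2 * ‖g‖ₑ ^ 2 := fun t => by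
      rw [lintegral_const_mul _ (by fun_prop),
        lintegral_sub_left_eq_self (fun x => ‖g x‖ₑ ^ 2) t, lintegral_enorm_sq_eq]
    simp_rw [this]
    rw [lintegral_mul_const _ (by fun_prop), lintegral_enorm_sq_eq]
  -- By Hölder every `F x` is in `L¹`, but membership in `L²` is only obtained for almost every `x`,
  -- from finiteness of the double integral. Plancherel is needed only for those `x`.
  have hfin : ∀ᵐ x, ∫⁻ t, ‖F x t‖ₑ ^ 2 < ∞ := by
    refine ae_lt_top ?_ ?_
    · exact (hFm.enorm.pow_const 2).lintegral_prod_right'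
    · rw [htot]
      exact ENNReal.mul_ne_top (by simp) (by simp)
  have hF₁ : ∀ x, Integrable (F x) := fun x => by
    have h := (Lp.memLp f).star.integrable_mul
      ((Lp.memLp g).comp_measurePreserving (measurePreserving_sub_right volume x))
    exact h
  have hF₂ : ∀ᵐ x, MemLp (F x) 2 := by
    filter_upwards [hfin] with x hx
    refine ⟨(hF₁ x).aestronglyMeasurable, ?_⟩
    rw [eLpNorm_eq_lintegral_rpow_enorm_toReal (by norm_num) (by norm_num)]
    refine ENNReal.rpow_lt_top_of_nonneg (by norm_num) ?_
    simpa using hx.ne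
  have hz : ∀ z : Phase d, ‖⟪f, timeFreqShift z g⟫_ℂ‖ₑ ^ 2
      = (fun p : 𝔼 × 𝔼 => ‖(𝓕 (F p.1) : 𝔼 → ℂ) (-p.2)‖ₑ ^ 2) (phaseEquiv d z) := fun z => by
    rw [inner_timeFreqShift_eq_fourier, phaseEquiv_apply]
  have hm : Measurable fun p : 𝔼 × 𝔼 => ‖(𝓕 (F p.1) : 𝔼 → ℂ) (-p.2)‖ₑ ^ 2 := by
    have h := ((measurable_inner_timeFreqShift f g).enorm.pow_const 2).comp
      (phaseEquiv d).symm.measurable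
    convert h using 2 with p
    rw [Function.comp_apply, hz, MeasurableEquiv.apply_symm_apply]
  rw [lintegral_congr hz, measurePreserving_phaseEquiv.lintegral_comp hm,
    Measure.volume_eq_prod, lintegral_prod _ hm.aemeasurable, ← htot]
  refine lintegral_congr_ae ?_
  filter_upwards [hF₂] with x hx
  rw [lintegral_neg_eq_self (fun w => ‖(𝓕 (F x) : 𝔼 → ℂ) w‖ₑ ^ 2)]
  exact lintegral_enorm_fourier_sq (hF₁ x) hx

end Moyal

/-! ### Hilbert–Schmidt operators and cyclicity of the trace. -/

section HilbertSchmidt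

variable {H : Type*} [NormedAddCommGroup H] [InnerProductSpace ℂ H]

open ContinuousLinearMap

theorem tsum_enorm_inner_sq {ι : Type*} (b : HilbertBasis ι ℂ H) (x : H) :
    ∑' i, ‖⟪b i, x⟫_ℂ‖ₑ ^ 2 = ‖x‖ₑ ^ 2 := by
  have h := b.hasSum_inner_mul_inner x x
  have hl : (fun i => ⟪x, b i⟫_ℂ * ⟪b i, x⟫_ℂ) = fun i => ((‖⟪b i, x⟫_ℂ‖ ^ 2 : ℝ) : ℂ) := by
    ext i
    rw [← inner_conj_symm x, RCLike.conj_mul]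
    simp
  have hr : ⟪x, x⟫_ℂ = ((‖x‖ ^ 2 : ℝ) : ℂ) := by
    rw [inner_self_eq_norm_sq_to_K]
    simp
  rw [hl, hr] at h
  have h2 := (Complex.hasSum_ofReal).1 h
  simp_rw [← ofReal_norm, ← ENNReal.ofReal_pow (norm_nonneg _)]
  rw [← ENNReal.ofReal_tsum_of_nonneg (fun _ => by positivity) h2.summable, h2.tsum_eq]

variable [CompleteSpace H]

/-- The squared Hilbert–Schmidt norm `∑ᵢ ‖A eᵢ‖²`. -/
def hilbertSchmidtSq (A : H →L[ℂ] H) : ℝ≥0∞ := ∑' i, ‖A (someBasis H i)‖ₑ ^ 2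

theorem hilbertSchmidtSq_eq_tsum (A : H →L[ℂ] H) :
    hilbertSchmidtSq A = ∑' i, ∑' j, ‖⟪someBasis H j, A (someBasis H i)⟫_ℂ‖ₑ ^ 2 :=
  tsum_congr fun _ => (tsum_enorm_inner_sq _ _).symm

theorem hilbertSchmidtSq_adjoint (A : H →L[ℂ] H) :
    hilbertSchmidtSq (adjoint A) = hilbertSchmidtSq A := by
  rw [hilbertSchmidtSq_eq_tsum, hilbertSchmidtSq_eq_tsum, ENNReal.tsum_comm]
  refine tsum_congr fun i => tsum_congr fun j => ?_
  rw [adjoint_inner_right, ← ofReal_norm, ← ofReal_norm, norm_inner_symm]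

theorem hilbertSchmidtSq_comp_lt_top (X : H →L[ℂ] H) {A : H →L[ℂ] H}
    (hA : hilbertSchmidtSq A < ∞) : hilbertSchmidtSq (X ∘L A) < ∞ := by
  refine lt_of_le_of_lt (b := ‖X‖ₑ ^ 2 * hilbertSchmidtSq A) ?_
    (ENNReal.mul_lt_top (by simp) hA)
  rw [hilbertSchmidtSq, hilbertSchmidtSq, ← ENNReal.tsum_mul_left]
  refine ENNReal.tsum_le_tsum fun i => ?_
  rw [← mul_pow]
  gcongr
  exact X.le_opENorm _

/-- The bound `|ab| ≤ |a|² + |b|²` suffices. This absolute summability licenses the interchange of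
sums in `trace_comp_comm`. -/
theorem summable_inner_mul_inner {A B : H →L[ℂ] H} (hA : hilbertSchmidtSq A < ∞)
    (hB : hilbertSchmidtSq B < ∞) :
    Summable fun p : basisIndex H × basisIndex H =>
      ⟪someBasis H p.1, A (someBasis H p.2)⟫_ℂ * ⟪someBasis H p.2, B (someBasis H p.1)⟫_ℂ := by
  have key : ∀ (c : basisIndex H × basisIndex H → ℂ), ∑' p, ‖c p‖ₑ ^ 2 < ∞ →
      Summable fun p => ‖c p‖ ^ 2 := fun c hc => by
    have := ENNReal.summable_toReal hc.ne
    simpa using this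
  have h1 := key (fun p => ⟪someBasis H p.1, A (someBasis H p.2)⟫_ℂ) (by
    rw [ENNReal.tsum_prod', ENNReal.tsum_comm, ← hilbertSchmidtSq_eq_tsum]; exact hA)
  have h2 := key (fun p => ⟪someBasis H p.2, B (someBasis H p.1)⟫_ℂ) (by
    rw [ENNReal.tsum_prod', ← hilbertSchmidtSq_eq_tsum]; exact hB)
  refine (h1.add h2).of_norm_bounded fun p => ?_
  rw [norm_mul]
  nlinarith [sq_nonneg (‖⟪someBasis H p.1, A (someBasis H p.2)⟫_ℂ‖ -
    ‖⟪someBasis H p.2, B (someBasis H p.1)⟫_ℂ‖),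
    norm_nonneg ⟪someBasis H p.1, A (someBasis H p.2)⟫_ℂ,
    norm_nonneg ⟪someBasis H p.2, B (someBasis H p.1)⟫_ℂ]

theorem trace_comp_eq_tsum (A B : H →L[ℂ] H) :
    trace (A ∘L B) = ∑' i, ∑' j,
      ⟪someBasis H i, A (someBasis H j)⟫_ℂ * ⟪someBasis H j, B (someBasis H i)⟫_ℂ := by
  refine tsum_congr fun i => ?_
  rw [comp_apply, ← adjoint_inner_left, ← (someBasis H).tsum_inner_mul_inner]
  simp_rw [adjoint_inner_left]

/-- The trace of a product of two Hilbert–Schmidt operators is cyclic. -/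
theorem trace_comp_comm {A B : H →L[ℂ] H} (hA : hilbertSchmidtSq A < ∞)
    (hB : hilbertSchmidtSq B < ∞) : trace (A ∘L B) = trace (B ∘L A) := by
  rw [trace_comp_eq_tsum, trace_comp_eq_tsum]
  refine (Summable.tsum_comm (f := fun j i => ⟪someBasis H i, A (someBasis H j)⟫_ℂ *
    ⟪someBasis H j, B (someBasis H i)⟫_ℂ) ?_).trans ?_
  · exact (summable_inner_mul_inner hA hB).prod_symm
  · exact tsum_congr fun i => tsum_congr fun j => mul_comm _ _

theorem trace_comp_adjoint (A : H →L[ℂ] H) :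
    trace (A ∘L adjoint A) = ((hilbertSchmidtSq A).toReal : ℂ) := by
  rw [← hilbertSchmidtSq_adjoint, hilbertSchmidtSq, ENNReal.tsum_toReal_eq fun _ => by simp,
    Complex.ofReal_tsum]
  refine tsum_congr fun i => ?_
  rw [comp_apply, ← adjoint_inner_left, inner_self_eq_norm_sq_to_K]
  simp

/-- A density operator has the form `R²` with `R` self-adjoint of Hilbert–Schmidt norm one. -/
theorem IsDensityOperator.exists_sqrt {S : H →L[ℂ] H} (hS : IsDensityOperator S) :
    ∃ R : H →L[ℂ] H, adjoint R = R ∧ R ∘L R = S ∧ hilbertSchmidtSq R = 1 := by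
  have hS0 : 0 ≤ S := (nonneg_iff_isPositive S).2 hS.isPositive
  have hR : adjoint (CFC.sqrt S) = CFC.sqrt S :=
    ((nonneg_iff_isPositive _).1 (CFC.sqrt_nonneg S)).isSelfAdjoint.adjoint_eq
  have hRR : CFC.sqrt S ∘L CFC.sqrt S = S := CFC.sqrt_mul_sqrt_self S hS0
  refine ⟨CFC.sqrt S, hR, hRR, ?_⟩
  set R := CFC.sqrt S
  have hterm : ∀ i, ⟪someBasis H i, S (someBasis H i)⟫_ℂ = ((‖R (someBasis H i)‖ ^ 2 : ℝ) : ℂ) :=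
    fun i => by
      rw [← hRR, comp_apply, ← adjoint_inner_left, hR, inner_self_eq_norm_sq_to_K]
      simp
  have hsum := hS.isTraceClass
  have htr := hS.trace_eq_one
  -- Positivity gives `|S| = S`, so trace class means summability of `⟨eᵢ, S eᵢ⟩ = ‖R eᵢ‖²`.
  rw [IsTraceClass, CFC.abs_of_nonneg S hS0] at hsum
  rw [trace] at htr
  simp_rw [hterm] at hsum htr
  rw [Complex.summable_ofReal] at hsum
  rw [← Complex.ofReal_tsum, Complex.ofReal_eq_one] at htr
  simp_rw [hilbertSchmidtSq, ← ofReal_norm, ← ENNReal.ofReal_pow (norm_nonneg _)]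
  rw [← ENNReal.ofReal_tsum_of_nonneg (fun _ => by positivity) hsum, htr, ENNReal.ofReal_one]

end HilbertSchmidt

/-! ### The total correlation function as a probability density. -/

section TotalCorrelation

open ContinuousLinearMap

variable {d : ℕ}

theorem parity_parity (f : Signal d) : parity d (parity d f) = f := by
  refine Lp.ext ?_
  have h1 := Lp.coeFn_compMeasurePreserving (parity d f) (Measure.measurePreserving_neg
    (volume : Measure (EuclideanSpace ℝ (Fin d))))
  have h2 := Lp.coeFn_compMeasurePreserving f (Measure.measurePreserving_neg
    (volume : Measure (EuclideanSpace ℝ (Fin d))))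
  have h3 := (Measure.measurePreserving_neg
    (volume : Measure (EuclideanSpace ℝ (Fin d)))).quasiMeasurePreserving.ae_eq_comp h2
  refine h1.trans (h3.trans ?_)
  exact Filter.Eventually.of_forall fun t => by simp

theorem opCheck_opCheck (T : Signal d →L[ℂ] Signal d) : opCheck (opCheck T) = T := by
  ext1 f
  simp [opCheck, parity_parity]

theorem exists_totalCorrelation_eq {S : Signal d →L[ℂ] Signal d} (hS : IsDensityOperator S) :
    ∃ f : basisIndex (Signal d) → Signal d, ∑' i, ‖f i‖ₑ ^ 2 = 1 ∧ ∀ z,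
      0 ≤ totalCorrelation S z ∧ ENNReal.ofReal (totalCorrelation S z) =
        ∑' i, ∑' j, ‖⟪f i, timeFreqShift z (f j)⟫_ℂ‖ₑ ^ 2 := by
  obtain ⟨R, hR, hRR, hR1⟩ := hS.exists_sqrt
  have hRfin : hilbertSchmidtSq R < ∞ := by rw [hR1]; exact ENNReal.one_lt_top
  refine ⟨fun i => R (someBasis _ i), hR1, fun z => ?_⟩
  set P := timeFreqShift z
  set C := R ∘L P ∘L R with hC
  have hCadj : adjoint C = R ∘L adjoint P ∘L R := by
    rw [hC, adjoint_comp, adjoint_comp, hR, comp_assoc]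
  have hCfin : hilbertSchmidtSq C < ∞ := by
    rw [hC, ← comp_assoc]
    exact hilbertSchmidtSq_comp_lt_top _ hRfin
  have hBfin : hilbertSchmidtSq (R ∘L opShift z S) < ∞ := by
    rw [← hilbertSchmidtSq_adjoint, adjoint_comp, hR]
    exact hilbertSchmidtSq_comp_lt_top _ hRfin
  have htr : opConv S (opCheck S) z = ((hilbertSchmidtSq C).toReal : ℂ) := by
    rw [opConv, opCheck_opCheck, ← trace_comp_adjoint C, hCadj]
    -- Only the left factor `S` stays split, giving `R ∘ (R ∘ α_z(S))` with both factors
    -- Hilbert–Schmidt, so that one `R` can be cycled to the right.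
    conv_lhs => rw [← hRR, comp_assoc, hRR]
    rw [trace_comp_comm hRfin hBfin, opShift, ← hRR, hC]
    simp only [comp_assoc]
    rfl
  have htot : totalCorrelation S z = (hilbertSchmidtSq C).toReal := by
    rw [totalCorrelation, htr, Complex.ofReal_re]
  refine ⟨htot ▸ ENNReal.toReal_nonneg, ?_⟩
  rw [htot, ENNReal.ofReal_toReal hCfin.ne, hilbertSchmidtSq_eq_tsum, ENNReal.tsum_comm]
  refine tsum_congr fun i => tsum_congr fun j => ?_
  rw [hC, comp_apply, comp_apply, ← adjoint_inner_left, hR]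

/-- The basis index set is not known to be countable, while exchanging sums with integrals requires
it; discarding zero vectors repairs this. -/
theorem countable_support_of_tsum_enorm_sq {ι : Type*} {f : ι → Signal d}
    (hf : ∑' i, ‖f i‖ₑ ^ 2 = 1) : f.support.Countable := by
  have h := (ENNReal.summable_toReal (f := fun i => ‖f i‖ₑ ^ 2) (by simp [hf])).countable_support
  convert h using 1
  ext i
  simp

theorem totalCorrelation_nonneg {S : Signal d →L[ℂ] Signal d} (hS : IsDensityOperator S)
    (z : Phase d) : 0 ≤ totalCorrelation S z :=
  ((exists_totalCorrelation_eq hS).choose_spec.2 z).1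

/-- The total correlation function is measurable with integral one. -/
theorem measurable_totalCorrelation_and_lintegral {S : Signal d →L[ℂ] Signal d}
    (hS : IsDensityOperator S) :
    Measurable (totalCorrelation S) ∧
      ∫⁻ z, ENNReal.ofReal (totalCorrelation S z) = 1 := by
  obtain ⟨f, hf, hz⟩ := exists_totalCorrelation_eq hS
  have : Countable f.support := (countable_support_of_tsum_enorm_sq hf).to_subtype
  have hsub : ∀ u : Signal d → ℝ≥0∞, u 0 = 0 → ∑' i, u (f i) = ∑' i : f.support, u (f i) :=
    fun u hu => by
      refine (tsum_subtype_eq_of_support_subset fun i hi h0 => ?_).symm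
      exact hi (by simp [h0, hu])
  have hz' : ∀ z, ENNReal.ofReal (totalCorrelation S z) =
      ∑' i : f.support, ∑' j : f.support, ‖⟪f i, timeFreqShift z (f j)⟫_ℂ‖ₑ ^ 2 := fun z => by
    rw [(hz z).2, hsub (fun x => ∑' j, ‖⟪x, timeFreqShift z (f j)⟫_ℂ‖ₑ ^ 2) (by simp)]
    refine tsum_congr fun i => ?_
    exact hsub (fun y => ‖⟪f i, timeFreqShift z y⟫_ℂ‖ₑ ^ 2) (by simp)
  have hm : ∀ i j, Measurable fun z : Phase d => ‖⟪f i, timeFreqShift z (f j)⟫_ℂ‖ₑ ^ 2 :=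
    fun i j => (measurable_inner_timeFreqShift _ _).enorm.pow_const 2
  constructor
  · have h : Measurable fun z => (ENNReal.ofReal (totalCorrelation S z)).toReal := by
      simp_rw [hz']
      exact (Measurable.tsum fun i : f.support =>
        Measurable.tsum fun j : f.support => hm i j).ennreal_toReal
    simpa only [fun z => ENNReal.toReal_ofReal (hz z).1] using h
  · simp_rw [hz']
    rw [lintegral_tsum fun i : f.support =>
      (Measurable.tsum fun j : f.support => hm i j).aemeasurable]
    simp_rw [fun i : f.support => lintegral_tsum (μ := volume) fun j : f.support =>
      (hm i j).aemeasurable, lintegral_enorm_inner_timeFreqShift_sq, ENNReal.tsum_mul_left,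
      ENNReal.tsum_mul_right]
    rw [← hsub (fun x => ‖x‖ₑ ^ 2) (by simp), hf, one_mul]

end TotalCorrelation

/-! ### Translations of a set and its perimeter. -/

section Perimeter

variable {E : Type*} [NormedAddCommGroup E] [NormedSpace ℝ E] 

/-- The average of `ψ` over the segment from `x - h` to `x`. -/
def segmentAverage (ψ : E → ℝ) (h x : E) : ℝ := ∫ s in (0 : ℝ)..1, ψ (x - s • h)

theorem hasFDerivAt_segmentAverage {ψ : E → ℝ} (hψ : ContDiff ℝ 1 ψ) (hc : HasCompactSupport ψ)
    (h x : E) :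
    HasFDerivAt (segmentAverage ψ h) (∫ s in (0 : ℝ)..1, fderiv ℝ ψ (x - s • h)) x := by
  have hd : Continuous (fderiv ℝ ψ) := hψ.continuous_fderiv (by norm_num)
  obtain ⟨C, hC⟩ := (hc.fderiv (𝕜 := ℝ)).exists_bound_of_continuous hd
  refine intervalIntegral.hasFDerivAt_integral_of_dominated_of_fderiv_le (s := Set.univ)
    (F := fun x (s : ℝ) => ψ (x - s • h)) (F' := fun x s => fderiv ℝ ψ (x - s • h))
    (bound := fun _ => C) Filter.univ_mem ?_ ?_ ?_ ?_ ?_ ?_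
  · refine Filter.Eventually.of_forall fun y => ?_
    exact (hψ.continuous.comp (by fun_prop)).aestronglyMeasurable
  · exact (hψ.continuous.comp (by fun_prop)).intervalIntegrable _ _
  · exact (hd.comp (by fun_prop)).aestronglyMeasurable
  · exact Filter.Eventually.of_forall fun t _ y _ => hC _
  · exact intervalIntegrable_const
  · refine Filter.Eventually.of_forall fun t _ y _ => ?_
    have h1 : HasFDerivAt ψ (fderiv ℝ ψ (y - t • h)) (y - t • h) :=
      (hψ.differentiable (by norm_num) _).hasFDerivAt
    have h2 : HasFDerivAt (fun z : E => z - t • h) (ContinuousLinearMap.id ℝ E) y :=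
      (hasFDerivAt_id y).sub_const _
    exact h1.comp y h2

theorem contDiff_segmentAverage {ψ : E → ℝ} (hψ : ContDiff ℝ 1 ψ) (hc : HasCompactSupport ψ)
    (h : E) : ContDiff ℝ 1 (segmentAverage ψ h) := by
  have hd : Continuous (fderiv ℝ ψ) := hψ.continuous_fderiv (by norm_num)
  refine contDiff_one_iff_fderiv.2
    ⟨fun x => (hasFDerivAt_segmentAverage hψ hc h x).differentiableAt, ?_⟩
  rw [funext fun x => (hasFDerivAt_segmentAverage hψ hc h x).fderiv]
  exact intervalIntegral.continuous_parametric_intervalIntegral_of_continuous'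
    (by exact hd.comp (by fun_prop)) 0 1

/-- In the direction `h` the integrand is the `s`-derivative of `-ψ (x - s • h)`, so the integral
telescopes. -/
theorem fderiv_segmentAverage_apply {ψ : E → ℝ} (hψ : ContDiff ℝ 1 ψ) (hc : HasCompactSupport ψ)
    (h x : E) : fderiv ℝ (segmentAverage ψ h) x h = ψ x - ψ (x - h) := by
  have hd : Continuous (fderiv ℝ ψ) := hψ.continuous_fderiv (by norm_num)
  have hd' : Continuous fun s : ℝ => fderiv ℝ ψ (x - s • h) := hd.comp (by fun_prop)
  rw [(hasFDerivAt_segmentAverage hψ hc h x).fderiv,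
    ContinuousLinearMap.intervalIntegral_apply (hd'.intervalIntegrable _ _)]
  have key : ∀ s ∈ Set.uIcc (0 : ℝ) 1,
      HasDerivAt (fun s : ℝ => -ψ (x - s • h)) (fderiv ℝ ψ (x - s • h) h) s := fun s _ => by
    have h1 : HasFDerivAt ψ (fderiv ℝ ψ (x - s • h)) (x - s • h) :=
      (hψ.differentiable (by norm_num) _).hasFDerivAt
    have h2 : HasDerivAt (fun s : ℝ => x - s • h) (-h) s := by
      simpa using ((hasDerivAt_id s).smul_const h).const_sub x
    have h3 := (h1.comp_hasDerivAt s h2).neg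
    rw [map_neg, neg_neg] at h3
    exact h3
  rw [intervalIntegral.integral_eq_sub_of_hasDerivAt key
    ((hd'.clm_apply continuous_const).intervalIntegrable _ _)]
  simp
  ring

theorem hasCompactSupport_segmentAverage {ψ : E → ℝ} (hc : HasCompactSupport ψ) (h : E) :
    HasCompactSupport (segmentAverage ψ h) := by
  have hK : IsCompact ((fun p : E × ℝ => p.1 + p.2 • h) '' (tsupport ψ ×ˢ Set.Icc (0 : ℝ) 1)) :=
    (hc.isCompact.prod isCompact_Icc).image (by fun_prop)
  refine HasCompactSupport.intro hK fun x hx => ?_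
  refine Eq.trans ?_ (intervalIntegral.integral_zero (E := ℝ) (μ := volume) (a := 0) (b := 1))
  refine intervalIntegral.integral_congr fun s hs => ?_
  rw [Set.uIcc_of_le zero_le_one] at hs
  by_contra hne
  exact hx ⟨(x - s • h, s), ⟨subset_tsupport ψ hne, hs⟩, by simp⟩

theorem abs_segmentAverage_le {ψ : E → ℝ} (h1 : ∀ x, |ψ x| ≤ 1) (h x : E) :
    |segmentAverage ψ h x| ≤ 1 := by
  simpa [segmentAverage] using intervalIntegral.norm_integral_le_of_norm_le_const (a := (0 : ℝ))
    (b := 1) (C := 1) (f := fun s => ψ (x - s • h)) fun s _ => h1 _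

variable {ι : Type*} [Fintype ι]

theorem ofReal_integral_sub_translate_le [DecidableEq ι] (Ω : Set (EuclideanSpace ℝ ι))
    {ψ : EuclideanSpace ℝ ι → ℝ} (hψ : ContDiff ℝ 1 ψ) (hc : HasCompactSupport ψ)
    (h1 : ∀ x, |ψ x| ≤ 1) (h : EuclideanSpace ℝ ι) :
    ENNReal.ofReal (∫ x in Ω, (ψ x - ψ (x - h))) ≤ ‖h‖ₑ * perimeter Ω := by
  rcases eq_or_ne h 0 with rfl | hh
  · simp
  have hn : 0 < ‖h‖ := norm_pos_iff.2 hh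
  set φ : EuclideanSpace ℝ ι → EuclideanSpace ℝ ι :=
    fun x => segmentAverage ψ h x • (‖h‖⁻¹ • h) with hφ
  have hs := contDiff_segmentAverage hψ hc h
  have hdiv : ∀ x, divergence φ x = ‖h‖⁻¹ * (ψ x - ψ (x - h)) := fun x => by
    have hfd : fderiv ℝ φ x = (fderiv ℝ (segmentAverage ψ h) x).smulRight (‖h‖⁻¹ • h) :=
      ((hs.differentiable (by norm_num) x).hasFDerivAt.smul_const _).fderiv
    have hsum : h = ∑ i, h i • EuclideanSpace.single i (1 : ℝ) := by
      ext j
      simp [Finset.sum_apply, Pi.single_apply]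
    rw [← fderiv_segmentAverage_apply hψ hc h x, divergence, hfd]
    conv_rhs => rw [hsum, map_sum, Finset.mul_sum]
    -- Restores the occurrences of `h` other than the direction of differentiation, which were
    -- expanded as well.
    rw [← hsum]
    refine Finset.sum_congr rfl fun i _ => ?_
    simp
    ring
  have hper : ENNReal.ofReal (∫ x in Ω, divergence φ x) ≤ perimeter Ω := by
    refine le_iSup₂_of_le φ (hs.smul contDiff_const) (le_iSup₂_of_le ?_ ?_ le_rfl)
    · exact (hasCompactSupport_segmentAverage hc h).smul_right
    · intro x
      rw [hφ, norm_smul, norm_smul, norm_inv, norm_norm, inv_mul_cancel₀ hn.ne', mul_one]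
      exact abs_segmentAverage_le h1 h x
  rw [funext hdiv, integral_const_mul] at hper
  calc ENNReal.ofReal (∫ x in Ω, (ψ x - ψ (x - h)))
      = ENNReal.ofReal (‖h‖ * (‖h‖⁻¹ * ∫ x in Ω, (ψ x - ψ (x - h)))) := by
        rw [mul_inv_cancel_left₀ hn.ne']
    _ = ‖h‖ₑ * ENNReal.ofReal (‖h‖⁻¹ * ∫ x in Ω, (ψ x - ψ (x - h))) := by
        rw [ENNReal.ofReal_mul hn.le, ofReal_norm]
    _ ≤ _ := by gcongr

/-- A smooth cutoff function which is `1` on the compact set `K` and `0` off the open set `U`. -/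
theorem exists_contDiff_eq_one_of_isCompact {K U : Set (EuclideanSpace ℝ ι)} (hK : IsCompact K)
    (hU : IsOpen U) (hKU : K ⊆ U) :
    ∃ ψ : EuclideanSpace ℝ ι → ℝ, ContDiff ℝ 1 ψ ∧ HasCompactSupport ψ ∧ (∀ x, 0 ≤ ψ x) ∧
      (∀ x, ψ x ≤ 1) ∧ (∀ x ∉ U, ψ x = 0) ∧ ∀ x ∈ K, ψ x = 1 := by
  -- Intersecting `U` with a ball around `K` keeps the support of the cutoff bounded.
  obtain ⟨R, hR⟩ := hK.isBounded.subset_ball 0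
  obtain ⟨ψ, hψ, hr, hs, h1⟩ := exists_contMDiff_support_eq_eq_one_iff (n := 1)
    (modelWithCornersSelf ℝ (EuclideanSpace ℝ ι)) (hU.inter Metric.isOpen_ball) hK.isClosed
    (Set.subset_inter hKU hR)
  refine ⟨ψ, hψ.contDiff, ?_, fun x => (hr ⟨x, rfl⟩).1, fun x => (hr ⟨x, rfl⟩).2, fun x hx => ?_,
    fun x hx => (h1 x).1 hx⟩
  · refine HasCompactSupport.of_support_subset_isCompact (isCompact_closedBall 0 R) ?_
    rw [hs]
    exact Set.inter_subset_right.trans Metric.ball_subset_closedBall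
  · by_contra hne
    have : x ∈ Function.support ψ := hne
    rw [hs] at this
    exact hx this.1

/-- The part of `Ω` that is moved out of `Ω` by the translation by `h` has measure at most
`|h| |∂Ω|`. -/
theorem volume_inter_translate_compl_le [DecidableEq ι] {Ω : Set (EuclideanSpace ℝ ι)}
    (hΩ : IsCompact Ω)
    (h : EuclideanSpace ℝ ι) :
    volume (Ω ∩ {x | x + h ∉ Ω}) ≤ ‖h‖ₑ * perimeter Ω := by
  set A := Ω ∩ {x | x + h ∉ Ω} with hA
  have hΩm := hΩ.measurableSet
  have hAm : MeasurableSet A :=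
    hΩm.inter ((measurable_add_const h) hΩm).compl
  have hAfin : volume A ≠ ∞ :=
    ((measure_mono Set.inter_subset_left).trans_lt hΩ.measure_lt_top).ne
  refine ENNReal.le_of_forall_pos_le_add fun ε hε _ => ?_
  have hε2 : ((ε / 2 : NNReal) : ℝ≥0∞) ≠ 0 := by simpa using hε.ne'
  -- Half of `ε` pays for `A` outside `K`, the other half for `U \ K`, where the cutoff is
  -- uncontrolled between 0 and 1.
  obtain ⟨K, hKA, hK, hAK⟩ := hAm.exists_isCompact_lt_add hAfin hε2
  obtain ⟨U, hKU, hU, hUK⟩ := K.exists_isOpen_lt_add (μ := volume) hK.measure_lt_top.ne hε2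
  obtain ⟨ψ, hψs, hψc, hψ0, hψ1, hψU, hψK⟩ := exists_contDiff_eq_one_of_isCompact hK hU hKU
  have hψa : ∀ x, |ψ x| ≤ 1 := fun x => by rw [abs_of_nonneg (hψ0 x)]; exact hψ1 x
  have hψi : Integrable ψ := hψs.continuous.integrable_of_hasCompactSupport hψc
  have hUK' : volume (U \ K) ≤ (ε / 2 : NNReal) := by
    rw [measure_sdiff hKU hK.measurableSet.nullMeasurableSet hK.measure_lt_top.ne]
    exact tsub_le_iff_left.2 hUK.le
  have hin : volume K ≤ ENNReal.ofReal (∫ x in Ω, ψ x) := by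
    rw [ofReal_integral_eq_lintegral_ofReal hψi.restrict (Filter.Eventually.of_forall hψ0)]
    calc volume K = ∫⁻ x in K, ENNReal.ofReal (ψ x) := by
          rw [setLIntegral_congr_fun (g := fun _ => 1) hK.measurableSet
            fun x hx => by simp [hψK x hx]]
          simp
      _ ≤ _ := lintegral_mono_set (hKA.trans Set.inter_subset_left)
  have hout : ENNReal.ofReal (∫ x in Ω, ψ (x - h)) ≤ (ε / 2 : NNReal) := by
    rw [ofReal_integral_eq_lintegral_ofReal (hψi.comp_sub_right h).restrict
      (Filter.Eventually.of_forall fun x => hψ0 _)]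
    calc ∫⁻ x in Ω, ENNReal.ofReal (ψ (x - h))
        ≤ ∫⁻ x in Ω, (U \ K).indicator (fun _ => (1 : ℝ≥0∞)) (x - h) := by
          refine setLIntegral_mono' hΩm fun x hx => ?_
          by_cases hxU : x - h ∈ U
          -- A point of `K ⊆ A` leaves `Ω` when moved by `h`, so `x ∈ Ω` excludes `x - h ∈ K`.
          · have hxK : x - h ∉ K := fun hk => (hKA hk).2 (by simpa using hx)
            rw [Set.indicator_of_mem (show x - h ∈ U \ K from ⟨hxU, hxK⟩)]
            simpa using hψ1 _
          · simp [hψU _ hxU]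
      _ ≤ ∫⁻ x, (U \ K).indicator (fun _ => (1 : ℝ≥0∞)) (x - h) := setLIntegral_le_lintegral _ _
      _ = volume (U \ K) := by
          rw [lintegral_sub_right_eq_self (fun x => (U \ K).indicator (fun _ => (1 : ℝ≥0∞)) x) h,
            lintegral_indicator (hU.measurableSet.diff hK.measurableSet), setLIntegral_one]
      _ ≤ _ := hUK'
  have hsub : ∫ x in Ω, (ψ x - ψ (x - h)) = (∫ x in Ω, ψ x) - ∫ x in Ω, ψ (x - h) :=
    integral_sub hψi.restrict (hψi.comp_sub_right h).restrict
  calc volume A ≤ volume K + (ε / 2 : NNReal) := hAK.le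
    _ ≤ ENNReal.ofReal (∫ x in Ω, ψ x) + (ε / 2 : NNReal) := by gcongr
    _ ≤ ENNReal.ofReal (∫ x in Ω, (ψ x - ψ (x - h))) + (ε / 2 : NNReal) + (ε / 2 : NNReal) := by
        gcongr
        rw [← sub_add_cancel (∫ x in Ω, ψ x) (∫ x in Ω, ψ (x - h)), ← hsub]
        exact ENNReal.ofReal_add_le.trans (by gcongr)
    _ ≤ ‖h‖ₑ * perimeter Ω + ε := by
        rw [add_assoc, ← ENNReal.coe_add, add_halves]
        gcongr
        exact ofReal_integral_sub_translate_le Ω hψs hψc hψa h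

end Perimeter

/-! ### Average lack of concentration and the final estimate. -/

section Concentration

variable {d : ℕ}

/-- The average lack of concentration of a probability density is controlled by the measure of
the parts of `Ω` moved out of `Ω` by translations. -/
theorem ofReal_ALC_le {f : Phase d → ℝ} (hf0 : ∀ z, 0 ≤ f z) (hfm : Measurable f)
    (hf1 : ∫⁻ z, ENNReal.ofReal (f z) = 1) {Ω : Set (Phase d)} (hΩ : IsCompact Ω)
    (hΩ_pos : 0 < volume Ω) :
    ENNReal.ofReal (ALC f Ω) ≤
      (volume Ω)⁻¹ * ∫⁻ z', ENNReal.ofReal (f z') * volume (Ω ∩ {z | z + z' ∉ Ω}) := by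
  have hΩm := hΩ.measurableSet
  have hfi : Integrable f := ⟨hfm.aestronglyMeasurable, by
    rw [hasFiniteIntegral_iff_ofReal (Filter.Eventually.of_forall hf0), hf1]
    exact ENNReal.one_lt_top⟩
  have hf1' : ∫ z, f z = 1 := by
    rw [integral_eq_lintegral_of_nonneg_ae (Filter.Eventually.of_forall hf0)
      hfm.aestronglyMeasurable, hf1, ENNReal.toReal_one]
  have hB : MeasurableSet {p : Phase d × Phase d | p.2 + p.1 ∈ Ω} :=
    (measurable_snd.add measurable_fst) hΩm
  have hBz : ∀ z, MeasurableSet {w : Phase d | w + z ∈ Ω} := fun z =>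
    (measurable_add_const z) hΩm
  have hcompl : ∀ z, 1 - ∫ z' in {w | w + z ∈ Ω}, f z' = ∫ z' in {w | w + z ∈ Ω}ᶜ, f z' :=
      fun z => by
    rw [← hf1', ← integral_add_compl (hBz z) hfi, add_sub_cancel_left]
  have hind : ∀ z, ENNReal.ofReal (∫ z' in {w | w + z ∈ Ω}ᶜ, f z') =
      ∫⁻ z', ({w | w + z ∈ Ω}ᶜ).indicator (fun z' => ENNReal.ofReal (f z')) z' := fun z => by
    rw [lintegral_indicator (hBz z).compl, ofReal_integral_eq_lintegral_ofReal hfi.integrableOn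
      (Filter.Eventually.of_forall hf0)]
  have hjoint : Measurable fun p : Phase d × Phase d =>
      ({w | w + p.1 ∈ Ω}ᶜ).indicator (fun z' => ENNReal.ofReal (f z')) p.2 :=
    ((hfm.comp measurable_snd).ennreal_ofReal).indicator hB.compl
  rw [ALC, ENNReal.ofReal_mul (by positivity), Measure.real, ENNReal.ofReal_inv_of_pos
    (ENNReal.toReal_pos hΩ_pos.ne' hΩ.measure_lt_top.ne),
    ENNReal.ofReal_toReal hΩ.measure_lt_top.ne]
  gcongr
  calc ENNReal.ofReal (∫ z in Ω, (1 - ∫ z' in {w | w + z ∈ Ω}, f z'))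
      ≤ ∫⁻ z in Ω, ENNReal.ofReal (1 - ∫ z' in {w | w + z ∈ Ω}, f z') := by
        simp_rw [hcompl]
        -- Bounding by the norm avoids checking that the outer integrand is integrable on `Ω`.
        refine (ENNReal.ofReal_le_ofReal (le_abs_self _)).trans ?_
        rw [← Real.norm_eq_abs, ofReal_norm]
        refine (enorm_integral_le_lintegral_enorm _).trans (le_of_eq ?_)
        refine lintegral_congr fun z => ?_
        rw [Real.enorm_of_nonneg (integral_nonneg hf0)]
    _ = ∫⁻ z in Ω, ∫⁻ z', ({w | w + z ∈ Ω}ᶜ).indicator (fun z' => ENNReal.ofReal (f z')) z' := by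
        simp_rw [hcompl, hind]
    _ = ∫⁻ z', ∫⁻ z in Ω, ({w | w + z ∈ Ω}ᶜ).indicator (fun z' => ENNReal.ofReal (f z')) z' :=
        lintegral_lintegral_swap (by exact hjoint.aemeasurable)
    _ = ∫⁻ z', ENNReal.ofReal (f z') * volume (Ω ∩ {z | z + z' ∉ Ω}) := by
        refine lintegral_congr fun z' => ?_
        have hm : MeasurableSet {z | z + z' ∉ Ω} := (hBz z').compl
        have : ∀ z, ({w | w + z ∈ Ω}ᶜ).indicator (fun z' => ENNReal.ofReal (f z')) z' =
            ({z | z + z' ∉ Ω}).indicator (fun _ => ENNReal.ofReal (f z')) z := fun z => by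
          by_cases hz : z' + z ∈ Ω
          · simp [hz, add_comm z z']
          · simp [hz, add_comm z z']
        simp_rw [this]
        rw [lintegral_indicator hm, setLIntegral_const, Measure.restrict_apply hm, Set.inter_comm]

end Concentration

end QHA

end

theorem mainTheorem7 (d : ℕ)
    (S : QHA.Signal d →L[ℂ] QHA.Signal d) (hS : QHA.IsDensityOperator S)
    (Ω : Set (QHA.Phase d)) (hΩ : IsCompact Ω) (hΩ_pos : 0 < MeasureTheory.volume Ω) :
    ((QHA.ALC (QHA.totalCorrelation S) Ω : ℝ) : EReal) ≤
      ((QHA.perimeter Ω / MeasureTheory.volume Ω *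
        ∫⁻ z, ENNReal.ofReal (QHA.totalCorrelation S z * ‖z‖) : ENNReal) : EReal) := by
  obtain ⟨hm, h1⟩ := QHA.measurable_totalCorrelation_and_lintegral hS
  have h0 := QHA.totalCorrelation_nonneg hS
  -- Truncating ALC at 0 only increases it and moves the inequality to `[0, ∞]`, where an infinite
  -- perimeter or moment is harmless.
  refine le_trans (b := ((ENNReal.ofReal (QHA.ALC (QHA.totalCorrelation S) Ω) : ENNReal) : EReal))
    ?_ (EReal.coe_ennreal_le_coe_ennreal_iff.2 ?_)
  · rw [EReal.coe_ennreal_ofReal]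
    exact EReal.coe_le_coe_iff.2 (le_max_left _ _)
  refine (QHA.ofReal_ALC_le h0 hm h1 hΩ hΩ_pos).trans ?_
  rw [div_eq_mul_inv, mul_comm (QHA.perimeter Ω), mul_assoc,
    ← MeasureTheory.lintegral_const_mul (QHA.perimeter Ω) (by fun_prop)]
  refine mul_le_mul_right (MeasureTheory.lintegral_mono fun z => ?_) _
  calc ENNReal.ofReal (QHA.totalCorrelation S z) * MeasureTheory.volume (Ω ∩ {w | w + z ∉ Ω})
      ≤ ENNReal.ofReal (QHA.totalCorrelation S z) * (‖z‖ₑ * QHA.perimeter Ω) := by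
        gcongr
        exact QHA.volume_inter_translate_compl_le hΩ z
    _ = QHA.perimeter Ω * ENNReal.ofReal (QHA.totalCorrelation S z * ‖z‖) := by
        rw [ENNReal.ofReal_mul (h0 z), ofReal_norm]
        ring
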